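/- **Setting.** Let $(\mathcal X,\mathcal F)$ be a measurable space, $\mu$ a measure on it, $P$ a Markov kernel with stationary probability measure $\pi$, and $P^*$ a Markov kernel that is a time-reversal of $P$, i.e. $\pi(dx)P^*(x,dy)=\pi(dy)P(y,dx)$. Assume that $\pi(dx)=\pi(x)\,\mu(dx)$ with $\mu(\{x:\pi(x)=0\})=0$, and that $P(x,dy)=p(x,y)\,\mu(dy)$ and $P^*(x,dy)=p^*(x,y)\,\mu(dy)$ for every $x\in\mathcal X$, with jointly measurable densities $p,p^*$. **The two Metropolis–Hastings kernels.** For $n\ge 1$ let $p_n(x,\cdot)$ and $p_n^*(x,\cdot)$ be the $\mu$-densities of the $n$-step kernels $P^n(x,\cdot)$ and $P^{*n}(x,\cdot)$, and put $$r_n(x)=\int_{y\neq x}\bigl(p_n(x,y)-\min\{p_n^*(x,y),p_n(x,y)\}\bigr)\,\mu(dy),$$ $$M_1(P^n)(x,dy)=\min\{p_n^*(x,y),p_n(x,y)\}\,\mu(dy)+r_n(x)\,\delta_x(dy),$$ $$M_2(P^n)(x,dy)=\max\{p_n^*(x,y),p_n(x,y)\}\,\mu(dy)-r_n(x)\,\delta_x(dy).$$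 ($M_2(P^n)(x,\cdot)$ is in general only a signed measure.) **Uniform ergodicity.** A (possibly signed) kernel $K$ with $\pi K=\pi$ is called uniformly ergodic if there are $C<\infty$ and $\rho\in[0,1)$ such that $$\sup_{x\in\mathcal X}\|K^n(x,\cdot)-\pi\|_{TV}\le C\rho^n\qquad\text{for all } n\ge 1,$$ where $\|\nu_1-\nu_2\|_{TV}=\sup_{A\in\mathcal F}|\nu_1(A)-\nu_2(A)|$. **Theorem.** If $P$ and $P^*$ are both uniformly ergodic, then there is $N\in\mathbb N$ such that for all $n\ge N$ both $M_1(P^n)$ and $M_2(P^n)$ are uniformly ergodic. -/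

import Mathlib

open MeasureTheory ProbabilityTheory
open scoped ENNReal

noncomputable section

namespace MHReversal

variable {X : Type*} [MeasurableSpace X]

/-! ### General (possibly signed) kernels, their powers, and uniform ergodicity

A general kernel is a family of finite signed measures `K x`, `x : X`, with `x ↦ K x A` measurable
for every measurable `A`. -/

/-- A Markov kernel, seen as a family of signed measures. -/
def ofKernel (P : Kernel X X) [IsMarkovKernel P] : X → SignedMeasure X :=
  fun x => (P x).toSignedMeasure

/-- The action `K f (x) = ∫ f(y) K(x, dy)` of a general kernel on functions. -/
def act (K : X → SignedMeasure X) (f : X → ℝ) : X → ℝ :=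
  fun x => VectorMeasure.integral (K x) f (ContinuousLinearMap.lsmul ℝ ℝ).flip

/-- The `n`-step kernel `K^n(x, A) = (K^n 1_A)(x)`. -/
def iter (K : X → SignedMeasure X) (n : ℕ) (x : X) (A : Set X) : ℝ :=
  (act K)^[n] (A.indicator fun _ => 1) x

/-- Total variation distance `sup_A |ν₁(A) - ν₂(A)|`, the supremum over measurable sets `A`. -/
def tvDist (ν₁ ν₂ : Set X → ℝ) : ℝ≥0∞ :=
  ⨆ (A : Set X) (_ : MeasurableSet A), ENNReal.ofReal |ν₁ A - ν₂ A|

/-- `K` is a general kernel with stationary measure `π`, and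
`sup_x ‖K^n(x, ·) - π‖_TV ≤ C ρ^n` for all `n ≥ 1`, for some `C < ∞` and `ρ ∈ [0, 1)`. -/
structure UniformlyErgodic (K : X → SignedMeasure X) (π : Measure X) : Prop where
  measurable : ∀ A, MeasurableSet A → Measurable fun x => K x A
  integrable : ∀ A, MeasurableSet A → Integrable (fun x => K x A) π
  stationary : ∀ A, MeasurableSet A → ∫ x, K x A ∂π = π.real A
  bound : ∃ C ρ : ℝ, 0 ≤ ρ ∧ ρ < 1 ∧ ∀ n : ℕ, 1 ≤ n →
    ⨆ x, tvDist (iter K n x) π.real ≤ ENNReal.ofReal (C * ρ ^ n)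

/-! ### The two Metropolis-Hastings kernels

`μ` is the reference measure, `P` the kernel, `Ps` its time-reversal; the laws `P x` and `Ps x`
are meant to be absolutely continuous with respect to `μ`. -/

/-- The density `y ↦ k(x, y)` of `K(x, ·)` with respect to `μ`. -/
def dens (μ : Measure X) (K : Kernel X X) (x y : X) : ℝ :=
  ((K x).rnDeriv μ y).toReal

/-- `m₁(x, y) = min {p*(x, y), p(x, y)}`. -/
def m1 (μ : Measure X) (P Ps : Kernel X X) (x y : X) : ℝ :=
  min (dens μ Ps x y) (dens μ P x y)

/-- `m₂(x, y) = max {p*(x, y), p(x, y)}`. -/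
def m2 (μ : Measure X) (P Ps : Kernel X X) (x y : X) : ℝ :=
  max (dens μ Ps x y) (dens μ P x y)

/-- The rejection probability `r₁(x) = ∫_{y ≠ x} (p(x, y) - m₁(x, y)) μ(dy)`. -/
def r1 (μ : Measure X) (P Ps : Kernel X X) (x : X) : ℝ :=
  ∫ y in {y | y ≠ x}, (dens μ P x y - m1 μ P Ps x y) ∂μ

/-- The first MH kernel `M₁(x, dy) = m₁(x, y) μ(dy) + r₁(x) δ_x(dy)`. -/
def M1 (μ : Measure X) (P Ps : Kernel X X) (x : X) : SignedMeasure X :=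
  μ.withDensityᵥ (m1 μ P Ps x) + r1 μ P Ps x • (Measure.dirac x).toSignedMeasure

/-- The second MH kernel `M₂(x, dy) = m₂(x, y) μ(dy) - r₁(x) δ_x(dy)`. -/
def M2 (μ : Measure X) (P Ps : Kernel X X) (x : X) : SignedMeasure X :=
  μ.withDensityᵥ (m2 μ P Ps x) - r1 μ P Ps x • (Measure.dirac x).toSignedMeasure

/-- The Metropolis-Hastings acceptance probability, where `πx = π(x)`, `πy = π(y)`,
`pxy = p(x, y)`, `pyx = p(y, x)`. -/
def accept (πx πy pxy pyx : ℝ) : ℝ :=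
  if 0 < πx * pxy then min (πy * pyx / (πx * pxy)) 1 else 0

/-- `α₁(x, y) p(x, y) = min {p*(x, y), p(x, y)}` whenever `π(x) p*(x, y) = π(y) p(y, x)` and
`π(x) > 0`. So `m₁` is the density of the accepted moves with proposal `P` and target `π`. -/
theorem accept_mul_eq_min {πx πy pxy pyx psxy : ℝ} (hπ : 0 < πx) (hp : 0 ≤ pxy)
    (hps : 0 ≤ psxy) (h : πx * psxy = πy * pyx) :
    accept πx πy pxy pyx * pxy = min psxy pxy := by
  rcases hp.eq_or_lt with rfl | hp
  · simp [hps]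
  · have h1 : 0 < πx * pxy := mul_pos hπ hp
    rw [accept, if_pos h1, min_mul_of_nonneg _ _ hp.le, ← h, one_mul]
    congr 1
    field_simp

end MHReversal

end

/-! For large `n`, uniform ergodicity puts `P ^ n` and `Ps ^ n` within a small `δ` of `π` in total
variation, uniformly in the starting point, so their `μ`-densities lie within `2δ` of `f` in
`L¹(μ)`. As `|min a b - c| ≤ |a - c| + |b - c|`, the minimum of the two densities is within `4δ` of
`f`; the rejected mass is then at most `2δ + 4δ`. Hence `M1` is within `10δ` of `π` as an operator
on bounded functions (`abs_integral_mhKernel_sub_le`). Since `max + min` is the sum, `M2 = P ^ n +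
Ps ^ n - M1` (`M2_eq`), which is within `14δ` of `π`.

Closeness in one step suffices: if `K` fixes constants, preserves `π`-integrals and has `‖K - π‖ ≤ ε
< 1` in the sup-operator norm, then `K ^ n - π = (K - π) ^ n` has norm at most `ε ^ n`
(`abs_iter_sub_le`). Positivity of `K` plays no role, so signed kernels are covered.

Stationarity of `M1` is detailed balance (`isReversible_mhKernel`), which rests on the almost
everywhere identity `f(x) k*(x, y) = f(y) k(y, x)` for the `n`-step densities
(`IsReversal.ae_mul_eq`); that of `M2` follows by linearity. The remaining work passes from the
densities chosen point by point through `rnDeriv` to jointly measurable ones, and shows that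
excluding `y = x` in `r1` costs nothing even at atoms. -/

noncomputable section

namespace MHReversal

variable {X : Type*} [MeasurableSpace X]

/-! ### Point masses -/

theorem of_ae_of_measure_singleton_ne_zero {α : Type*} [MeasurableSpace α] {ν : Measure α}
    {q : α → Prop} (h : ∀ᵐ y ∂ν, q y) {x : α} (hx : ν {x} ≠ 0) : q x := by
  by_contra hq
  exact hx (measure_mono_null (by rintro y rfl; exact hq) (ae_iff.1 h))

/-- Removing a non-measurable point does not change a measure. -/
theorem restrict_ne_of_not_measurableSet {ν : Measure X} {x : X}
    (hx : ¬ MeasurableSet ({x} : Set X)) : ν.restrict {y | y ≠ x} = ν := by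
  ext t ht
  rw [Measure.restrict_apply ht]
  refine le_antisymm (measure_mono Set.inter_subset_left) ?_
  rw [← measure_toMeasurable (t ∩ {y | y ≠ x})]
  set s := toMeasurable ν (t ∩ {y | y ≠ x}) with hs
  have hsub : t ∩ {y | y ≠ x} ⊆ s := subset_toMeasurable _ _
  refine measure_mono fun y hy => ?_
  by_cases hyx : y = x
  · subst hyx
    by_contra hys
    refine hx ?_
    -- If the measurable hull `s` of `t` without the point missed that point, the point would be all
    -- of `t \ s`, hence measurable.
    have : ({y} : Set X) = t \ s := by
      ext z
      constructor
      · rintro rfl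
        exact ⟨hy, hys⟩
      · rintro ⟨hz, hzs⟩
        by_contra hzy
        exact hzs (hsub ⟨hz, hzy⟩)
    rw [this]
    exact ht.diff (measurableSet_toMeasurable _ _)
  · exact hsub ⟨hy, hyx⟩

/-- Only a measurable atom can contribute, and there the integrand vanishes; `{x}` itself need not
be measurable. -/
theorem setIntegral_ne_eq_integral {ν : Measure X} {g : X → ℝ} {x : X}
    (h : ν {x} ≠ 0 → g x = 0) : ∫ y in {y | y ≠ x}, g y ∂ν = ∫ y, g y ∂ν := by
  by_cases hx : MeasurableSet ({x} : Set X)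
  · refine setIntegral_eq_integral_of_ae_compl_eq_zero ?_
    by_cases h0 : ν {x} = 0
    · filter_upwards [compl_mem_ae_iff.2 h0] with y hy hyx
      exact absurd (not_not.1 hyx) hy
    · refine Filter.Eventually.of_forall fun y hyx => ?_
      rw [not_not.1 hyx]
      exact h h0
  · rw [restrict_ne_of_not_measurableSet hx]

/-! ### Total variation and integrals of bounded functions -/

/-- The positive and negative parts of `g` are each tested by one set; this is the factor 2 between
`sup_A` and the `L¹` norm. -/
theorem integral_abs_le_two_mul {ν : Measure X} {g : X → ℝ} (hg : Integrable g ν) {δ : ℝ}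
    (hgm : Measurable g)
    (h : ∀ A, MeasurableSet A → |∫ y in A, g y ∂ν| ≤ δ) : ∫ y, |g y| ∂ν ≤ 2 * δ := by
  have h1 := h _ (measurableSet_le measurable_const hgm : MeasurableSet {y | (0 : ℝ) ≤ g y})
  have h2 := h _ (measurableSet_le hgm measurable_const : MeasurableSet {y | g y ≤ (0 : ℝ)})
  have h3 := integral_norm_eq_pos_sub_neg hg
  simp only [Real.norm_eq_abs] at h3
  rw [h3]
  linarith [le_abs_self (∫ y in {y | 0 ≤ g y}, g y ∂ν), neg_abs_le (∫ y in {y | g y ≤ 0}, g y ∂ν)]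

theorem integrable_of_abs_le {ν : Measure X} [IsFiniteMeasure ν] {h : X → ℝ} (hm : Measurable h)
    {b : ℝ} (hb : ∀ x, |h x| ≤ b) : Integrable h ν :=
  Integrable.of_bound hm.aestronglyMeasurable b (Filter.Eventually.of_forall hb)

theorem integral_withDensity_sub_le {μ : Measure X} {u v : X → ℝ≥0∞} (hu : Measurable u)
    (hv : Measurable v) (hui : ∫⁻ y, u y ∂μ ≠ ∞) (hvi : ∫⁻ y, v y ∂μ ≠ ∞) {h : X → ℝ}
    (hm : Measurable h) {b : ℝ} (hb : ∀ x, |h x| ≤ b) :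
    |∫ y, h y ∂μ.withDensity u - ∫ y, h y ∂μ.withDensity v|
      ≤ b * ∫ y, |(u y).toReal - (v y).toReal| ∂μ := by
  have hu' := integrable_toReal_of_lintegral_ne_top hu.aemeasurable hui
  have hv' := integrable_toReal_of_lintegral_ne_top hv.aemeasurable hvi
  have hbd : ∀ᵐ x ∂μ, ‖h x‖ ≤ b := Filter.Eventually.of_forall hb
  rw [integral_withDensity_eq_integral_toReal_smul hu (ae_lt_top hu hui),
    integral_withDensity_eq_integral_toReal_smul hv (ae_lt_top hv hvi)]
  simp only [smul_eq_mul]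
  rw [← integral_sub (hu'.mul_bdd hm.aestronglyMeasurable hbd)
    (hv'.mul_bdd hm.aestronglyMeasurable hbd), ← integral_const_mul]
  refine (abs_integral_le_integral_abs).trans (integral_mono_of_nonneg
    (Filter.Eventually.of_forall fun _ => abs_nonneg _) ((hu'.sub hv').abs.const_mul b)
    (Filter.Eventually.of_forall fun y => ?_))
  simp only
  rw [← sub_mul, abs_mul, mul_comm]
  exact mul_le_mul_of_nonneg_right (hb y) (abs_nonneg _)

theorem integral_abs_toReal_sub_le {μ : Measure X} {u v : X → ℝ≥0∞} (hu : Measurable u)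
    (hv : Measurable v) (hui : ∫⁻ y, u y ∂μ ≠ ∞) (hvi : ∫⁻ y, v y ∂μ ≠ ∞) {δ : ℝ}
    (h : ∀ A, MeasurableSet A → |(μ.withDensity u).real A - (μ.withDensity v).real A| ≤ δ) :
    ∫ y, |(u y).toReal - (v y).toReal| ∂μ ≤ 2 * δ := by
  have hu' := integrable_toReal_of_lintegral_ne_top hu.aemeasurable hui
  have hv' := integrable_toReal_of_lintegral_ne_top hv.aemeasurable hvi
  refine integral_abs_le_two_mul (hu'.sub hv') (hu.ennreal_toReal.sub hv.ennreal_toReal)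
    fun A hA => ?_
  have key : ∀ w : X → ℝ≥0∞, Measurable w → ∫⁻ y, w y ∂μ ≠ ∞ →
      ∫ y in A, (w y).toReal ∂μ = (μ.withDensity w).real A := fun w hw hwi => by
    rw [integral_toReal hw.aemeasurable (ae_restrict_of_ae (ae_lt_top hw hwi)), measureReal_def,
      withDensity_apply _ hA]
  have := h A hA
  rw [← key u hu hui, ← key v hv hvi, ← integral_sub hu'.integrableOn hv'.integrableOn] at this
  exact this

/-! ### Geometric convergence of general kernels -/

/-- If `K` acts on bounded measurable functions, fixes constants, preserves `π`-integrals, and is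
within `ε` of `π` in operator norm, then its powers converge to `π` geometrically. -/
theorem abs_iter_sub_le {K : X → SignedMeasure X} {π : Measure X} [IsProbabilityMeasure π] {ε : ℝ}
    (hmeas : ∀ h : X → ℝ, ∀ b, Measurable h → (∀ x, |h x| ≤ b) → Measurable (act K h))
    (hsub : ∀ h : X → ℝ, ∀ b c, Measurable h → (∀ x, |h x| ≤ b) → ∀ x,
      act K (fun y => h y - c) x = act K h x - c)
    (hstat : ∀ h : X → ℝ, ∀ b, Measurable h → (∀ x, |h x| ≤ b) →
      ∫ x, act K h x ∂π = ∫ x, h x ∂π)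
    (hbd : ∀ h : X → ℝ, ∀ b, Measurable h → (∀ x, |h x| ≤ b) → ∀ x,
      |act K h x - ∫ y, h y ∂π| ≤ ε * b)
    {A : Set X} (hA : MeasurableSet A) (n : ℕ) :
    Measurable ((act K)^[n] (A.indicator fun _ => 1)) ∧
      ∫ x, (act K)^[n] (A.indicator fun _ => 1) x ∂π = π.real A ∧
      ∀ x, |(act K)^[n] (A.indicator fun _ => 1) x - π.real A| ≤ ε ^ n := by
  induction n with
  | zero =>
    refine ⟨measurable_const.indicator hA, ?_, fun x => ?_⟩
    · simp [integral_indicator hA]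
    · have h0 : 0 ≤ π.real A := measureReal_nonneg
      have h1 : π.real A ≤ 1 := measureReal_le_one
      by_cases hx : x ∈ A <;> simp [hx, abs_le] <;> linarith
  | succ n ih =>
    obtain ⟨ihm, ihi, ihb⟩ := ih
    rw [Function.iterate_succ_apply']
    set g := (act K)^[n] (A.indicator fun _ => 1) with hg
    have hgb : ∀ x, |g x| ≤ ε ^ n + |π.real A| := fun x => by
      have := abs_add_le (g x - π.real A) (π.real A)
      rw [sub_add_cancel] at this
      linarith [ihb x]
    refine ⟨hmeas g _ ihm hgb, (hstat g _ ihm hgb).trans ihi, fun x => ?_⟩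
    -- Centring is what gains a full factor `ε`: `g - π(A)` has `π`-mean zero and sup norm at most
    -- `ε ^ n`, so `hbd` bounds its image by `ε * ε ^ n`.
    have h0 : ∫ y, (g y - π.real A) ∂π = 0 := by
      rw [integral_sub (integrable_of_abs_le ihm hgb) (integrable_const _), ihi]
      simp
    have h1 := hbd (fun y => g y - π.real A) (ε ^ n) (ihm.sub_const _) ihb x
    rw [hsub g _ _ ihm hgb, h0, sub_zero] at h1
    rwa [pow_succ']

theorem UniformlyErgodic.of_act {K : X → SignedMeasure X} {π : Measure X} [IsProbabilityMeasure π]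
    {ε : ℝ} (hε : 0 ≤ ε) (hε1 : ε < 1)
    (hone : ∀ A, MeasurableSet A → ∀ x, act K (A.indicator fun _ => 1) x = K x A)
    (hmeas : ∀ h : X → ℝ, ∀ b, Measurable h → (∀ x, |h x| ≤ b) → Measurable (act K h))
    (hsub : ∀ h : X → ℝ, ∀ b c, Measurable h → (∀ x, |h x| ≤ b) → ∀ x,
      act K (fun y => h y - c) x = act K h x - c)
    (hstat : ∀ h : X → ℝ, ∀ b, Measurable h → (∀ x, |h x| ≤ b) →
      ∫ x, act K h x ∂π = ∫ x, h x ∂π)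
    (hbd : ∀ h : X → ℝ, ∀ b, Measurable h → (∀ x, |h x| ≤ b) → ∀ x,
      |act K h x - ∫ y, h y ∂π| ≤ ε * b) : UniformlyErgodic K π := by
  have key := fun (A : Set X) (hA : MeasurableSet A) (n : ℕ) =>
    abs_iter_sub_le hmeas hsub hstat hbd hA n
  have hact : ∀ A, MeasurableSet A → act K (A.indicator fun _ => 1) = fun x => K x A :=
    fun A hA => funext (hone A hA)
  refine ⟨fun A hA => ?_, fun A hA => ?_, fun A hA => ?_, 1, ε, hε, hε1, fun n _ => ?_⟩
  · rw [← hact A hA]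
    exact (key A hA 1).1
  · rw [← hact A hA]
    refine integrable_of_abs_le (key A hA 1).1 (b := ε ^ 1 + |π.real A|) fun x => ?_
    have := abs_add_le (act K (A.indicator fun _ => 1) x - π.real A) (π.real A)
    rw [sub_add_cancel] at this
    have h2 := (key A hA 1).2.2 x
    simp only [Function.iterate_one] at h2
    linarith
  · rw [← hact A hA]
    exact (key A hA 1).2.1
  · refine iSup_le fun x => iSup₂_le fun A hA => ENNReal.ofReal_le_ofReal ?_
    rw [one_mul]
    exact (key A hA n).2.2 x

/-! ### Densities and time-reversal of powers -/

/-- All the laws `K x` have densities with respect to `μ` that are jointly measurable. -/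
def HasJointDensity (μ : Measure X) (K : Kernel X X) : Prop :=
  ∃ k : X → X → ℝ≥0∞, Measurable (Function.uncurry k) ∧ ∀ x, K x = μ.withDensity (k x)

/-- Only the last step of the composition needs a density: averaging `k z y` over `L x (dz)` gives
one for the whole. -/
theorem HasJointDensity.comp {μ : Measure X} [SFinite μ] {K : Kernel X X}
    (hK : HasJointDensity μ K) (L : Kernel X X) [IsSFiniteKernel L] :
    HasJointDensity μ (K ∘ₖ L) := by
  obtain ⟨k, hk, hKk⟩ := hK
  refine ⟨fun x y => ∫⁻ z, k z y ∂L x, ?_, fun x => ?_⟩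
  · have h : Measurable fun q : (X × X) × X => k q.2 q.1.2 :=
      hk.comp (measurable_snd.prodMk (measurable_snd.comp measurable_fst))
    have := Measurable.lintegral_kernel_prod_right (κ := L.comap Prod.fst measurable_fst)
      (f := fun (q : X × X) z => k z q.2) h
    simpa [Function.uncurry_def] using this
  · ext A hA
    rw [Kernel.comp_apply' _ _ _ hA, withDensity_apply _ hA, lintegral_lintegral_swap]
    · simp_rw [hKk, withDensity_apply _ hA]
    · exact (hk.comp measurable_swap).aemeasurable

theorem isMarkovKernel_pow (K : Kernel X X) [IsMarkovKernel K] (n : ℕ) :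
    IsMarkovKernel (K ^ n) := by
  induction n with
  | zero =>
    rw [pow_zero]
    exact inferInstanceAs (IsMarkovKernel Kernel.id)
  | succ n ih =>
    rw [pow_succ]
    exact inferInstanceAs (IsMarkovKernel ((K ^ n) ∘ₖ K))

theorem HasJointDensity.pow {μ : Measure X} [SFinite μ] {K : Kernel X X} [IsMarkovKernel K]
    (hK : HasJointDensity μ K) {n : ℕ} (hn : 1 ≤ n) : HasJointDensity μ (K ^ n) := by
  obtain ⟨m, rfl⟩ := Nat.exists_eq_add_of_le' hn
  have := isMarkovKernel_pow K m
  rw [pow_succ']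
  exact hK.comp (K ^ m)

/-- `Ks` is the time-reversal of `K` with respect to `π`, tested against functions. -/
def IsReversal (π : Measure X) (K Ks : Kernel X X) : Prop :=
  ∀ u v : X → ℝ≥0∞, Measurable u → Measurable v →
    ∫⁻ x, u x * ∫⁻ y, v y ∂Ks x ∂π = ∫⁻ x, v x * ∫⁻ y, u y ∂K x ∂π

theorem isReversal_of_compProd_eq {π : Measure X} [SFinite π] {K Ks : Kernel X X}
    [IsSFiniteKernel K] [IsSFiniteKernel Ks]
    (h : π.compProd Ks = (π.compProd K).map Prod.swap) : IsReversal π K Ks := by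
  intro u v hu hv
  have h1 : Measurable fun q : X × X => u q.1 * v q.2 :=
    (hu.comp measurable_fst).mul (hv.comp measurable_snd)
  have h2 : Measurable fun q : X × X => u q.2 * v q.1 := h1.comp measurable_swap
  have key : ∫⁻ q, u q.1 * v q.2 ∂π.compProd Ks = ∫⁻ q, u q.2 * v q.1 ∂π.compProd K := by
    rw [h, lintegral_map h1 measurable_swap]
    rfl
  rw [Measure.lintegral_compProd h1, Measure.lintegral_compProd h2] at key
  simp only at key
  calc ∫⁻ x, u x * ∫⁻ y, v y ∂Ks x ∂π = ∫⁻ x, ∫⁻ y, u x * v y ∂Ks x ∂π := by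
        simp_rw [lintegral_const_mul _ hv]
    _ = ∫⁻ x, ∫⁻ y, u y * v x ∂K x ∂π := key
    _ = ∫⁻ x, v x * ∫⁻ y, u y ∂K x ∂π := by
        simp_rw [lintegral_mul_const _ hu, mul_comm]

/-- Testing against functions lets each kernel be moved across in turn, which reverses their order.
-/
theorem IsReversal.comp {π : Measure X} {K Ks L Ls : Kernel X X} (hK : IsReversal π K Ks)
    (hL : IsReversal π L Ls) : IsReversal π (K ∘ₖ L) (Ls ∘ₖ Ks) := by
  intro u v hu hv
  simp_rw [Kernel.lintegral_comp _ _ _ hu, Kernel.lintegral_comp _ _ _ hv]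
  rw [hK u _ hu hv.lintegral_kernel, ← hL _ v hu.lintegral_kernel hv]
  simp_rw [mul_comm]

theorem IsReversal.pow {π : Measure X} {K Ks : Kernel X X} (hK : IsReversal π K Ks) (n : ℕ) :
    IsReversal π (K ^ n) (Ks ^ n) := by
  induction n with
  | zero =>
    intro u v hu hv
    simp only [pow_zero]
    change ∫⁻ x, u x * ∫⁻ y, v y ∂Kernel.id x ∂π = ∫⁻ x, v x * ∫⁻ y, u y ∂Kernel.id x ∂π
    simp_rw [Kernel.id_apply, lintegral_dirac' _ hu, lintegral_dirac' _ hv, mul_comm]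
  | succ n ih =>
    -- The new factor is split off on opposite sides because reversal swaps the order of
    -- composition.
    rw [pow_succ', pow_succ]
    exact hK.comp ih

/-- The balance equation `f(x) k*(x, y) = f(y) k(y, x)` of a kernel and its time-reversal. -/
theorem IsReversal.ae_mul_eq {μ : Measure X} [SigmaFinite μ] {f : X → ℝ≥0∞} (hf : Measurable f)
    [IsProbabilityMeasure (μ.withDensity f)] {K Ks : Kernel X X} [IsMarkovKernel Ks]
    (hrev : IsReversal (μ.withDensity f) K Ks) {k ks : X → X → ℝ≥0∞}
    (hk : Measurable (Function.uncurry k)) (hks : Measurable (Function.uncurry ks))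
    (hK : ∀ x, K x = μ.withDensity (k x)) (hKs : ∀ x, Ks x = μ.withDensity (ks x)) :
    ∀ᵐ q ∂μ.prod μ, f q.1 * ks q.1 q.2 = f q.2 * k q.2 q.1 := by
  have hm1 : Measurable fun q : X × X => f q.1 * ks q.1 q.2 := (hf.comp measurable_fst).mul hks
  have hm2 : Measurable fun q : X × X => f q.2 * k q.2 q.1 :=
    (hf.comp measurable_snd).mul (hk.comp measurable_swap)
  have hks' : ∀ x, Measurable (ks x) := fun x => hks.comp measurable_prodMk_left
  have hk' : ∀ x, Measurable (k x) := fun x => hk.comp measurable_prodMk_left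
  have e1 : ∀ A B, MeasurableSet A → MeasurableSet B →
      (μ.prod μ).withDensity (fun q => f q.1 * ks q.1 q.2) (A ×ˢ B)
        = ∫⁻ x in A, Ks x B ∂μ.withDensity f := fun A B hA hB => by
    rw [withDensity_apply _ (hA.prod hB), ← Measure.prod_restrict,
      lintegral_prod _ hm1.aemeasurable,
      setLIntegral_withDensity_eq_setLIntegral_mul _ hf (Ks.measurable_coe hB) hA]
    refine lintegral_congr fun x => ?_
    rw [Pi.mul_apply, hKs, withDensity_apply _ hB, ← lintegral_const_mul _ (hks' x)]
  have e2 : ∀ A B, MeasurableSet A → MeasurableSet B →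
      (μ.prod μ).withDensity (fun q => f q.2 * k q.2 q.1) (A ×ˢ B)
        = ∫⁻ x in B, K x A ∂μ.withDensity f := fun A B hA hB => by
    rw [withDensity_apply _ (hA.prod hB), ← Measure.prod_restrict,
      lintegral_prod_symm _ hm2.aemeasurable,
      setLIntegral_withDensity_eq_setLIntegral_mul _ hf (K.measurable_coe hA) hB]
    refine lintegral_congr fun x => ?_
    rw [Pi.mul_apply, hK, withDensity_apply _ hA, ← lintegral_const_mul _ (hk' x)]
  -- Finite total mass allows both equality of measures to be checked on rectangles and densities to
  -- be recovered from measures.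
  have hfin : ∫⁻ q, f q.1 * ks q.1 q.2 ∂μ.prod μ ≠ ∞ := by
    have := e1 Set.univ Set.univ .univ .univ
    rw [Set.univ_prod_univ, withDensity_apply _ .univ, Measure.restrict_univ] at this
    rw [this]
    simp
  have : IsFiniteMeasure ((μ.prod μ).withDensity fun q => f q.1 * ks q.1 q.2) :=
    isFiniteMeasure_withDensity hfin
  refine (withDensity_eq_iff hm1.aemeasurable hm2.aemeasurable hfin).1
    (Measure.ext_prod fun {A B} hA hB => ?_)
  rw [e1 A B hA hB, e2 A B hA hB]
  have := hrev (A.indicator 1) (B.indicator 1) (measurable_one.indicator hA)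
    (measurable_one.indicator hB)
  simp only [lintegral_indicator_one hA, lintegral_indicator_one hB] at this
  rw [← lintegral_indicator hA, ← lintegral_indicator hB]
  convert this using 2 with x x
  · ext x
    by_cases hx : x ∈ A <;> simp [hx]
  · ext x
    by_cases hx : x ∈ B <;> simp [hx]

/-! ### The first Metropolis-Hastings kernel as a Markov kernel -/

/-- The rejection probability in terms of jointly measurable densities. -/
def rej (μ : Measure X) (k ks : X → X → ℝ≥0∞) (x : X) : ℝ≥0∞ :=
  ∫⁻ y, (k x y - min (ks x y) (k x y)) ∂μ

/-- The kernel `min {k*(x, y), k(x, y)} μ(dy) + rej(x) δ_x(dy)`. -/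
def mhKernel (μ : Measure X) [SFinite μ] (k ks : X → X → ℝ≥0∞) : Kernel X X :=
  Kernel.withDensity (Kernel.const X μ) (fun x y => min (ks x y) (k x y)) +
    Kernel.withDensity Kernel.id fun x _ => rej μ k ks x

theorem measurable_uncurry_min {k ks : X → X → ℝ≥0∞} (hk : Measurable (Function.uncurry k))
    (hks : Measurable (Function.uncurry ks)) :
    Measurable (Function.uncurry fun x y => min (ks x y) (k x y)) :=
  hks.min hk

theorem measurable_rej {μ : Measure X} [SFinite μ] {k ks : X → X → ℝ≥0∞}
    (hk : Measurable (Function.uncurry k)) (hks : Measurable (Function.uncurry ks)) :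
    Measurable (rej μ k ks) :=
  Measurable.lintegral_prod_right' (f := fun q : X × X => k q.1 q.2 - min (ks q.1 q.2) (k q.1 q.2))
    (hk.sub (hks.min hk))

theorem mhKernel_apply {μ : Measure X} [SFinite μ] {k ks : X → X → ℝ≥0∞}
    (hk : Measurable (Function.uncurry k)) (hks : Measurable (Function.uncurry ks))
    (x : X) : mhKernel μ k ks x =
    μ.withDensity (fun y => min (ks x y) (k x y)) + rej μ k ks x • Measure.dirac x := by
  have hr : Measurable (Function.uncurry fun (x : X) (_ : X) => rej μ k ks x) :=
    (measurable_rej hk hks).comp measurable_fst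
  rw [mhKernel, add_apply, Kernel.withDensity_apply _ (measurable_uncurry_min hk hks),
    Kernel.withDensity_apply _ hr, withDensity_const,
    Kernel.const_apply, Kernel.id_apply]

theorem isMarkovKernel_mhKernel {μ : Measure X} [SFinite μ] {k ks : X → X → ℝ≥0∞}
    (hk : Measurable (Function.uncurry k)) (hks : Measurable (Function.uncurry ks))
    (h1 : ∀ x, ∫⁻ y, k x y ∂μ = 1) :
    IsMarkovKernel (mhKernel μ k ks) := by
  have hk' : ∀ x, Measurable (k x) := fun x => hk.comp measurable_prodMk_left
  have hks' : ∀ x, Measurable (ks x) := fun x => hks.comp measurable_prodMk_left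
  refine ⟨fun x => ⟨?_⟩⟩
  rw [mhKernel_apply hk hks, Measure.add_apply, Measure.smul_apply,
    withDensity_apply _ .univ, Measure.restrict_univ, measure_univ, smul_eq_mul, mul_one, rej,
    ← lintegral_add_left ((hks' x).min (hk' x)), ← h1 x]
  exact lintegral_congr fun y => add_tsub_cancel_of_le (min_le_right _ _)

/-- Detailed balance for the first Metropolis-Hastings kernel. -/
theorem isReversible_mhKernel {μ : Measure X} [SFinite μ] {k ks : X → X → ℝ≥0∞}
    (hk : Measurable (Function.uncurry k)) (hks : Measurable (Function.uncurry ks))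
    {f : X → ℝ≥0∞} (hf : Measurable f)
    (hbal : ∀ᵐ q ∂μ.prod μ, f q.1 * ks q.1 q.2 = f q.2 * k q.2 q.1) :
    (mhKernel μ k ks).IsReversible (μ.withDensity f) := by
  intro A B hA hB
  have hm := measurable_uncurry_min hk hks
  -- Balance at `(x, y)` and at `(y, x)` exchanges the two arguments of the minimum.
  have hbal' : ∀ᵐ q ∂μ.prod μ, f q.1 * min (ks q.1 q.2) (k q.1 q.2)
      = f q.2 * min (ks q.2 q.1) (k q.2 q.1) := by
    have hsw := (Measure.measurePreserving_swap (μ := μ) (ν := μ)).quasiMeasurePreserving.ae hbal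
    filter_upwards [hbal, hsw] with q h1 h2
    simp only [Prod.fst_swap, Prod.snd_swap] at h2
    rw [mul_min, mul_min, h1, h2, min_comm]
  have hmeas : Measurable fun q : X × X => f q.1 * min (ks q.1 q.2) (k q.1 q.2) :=
    (hf.comp measurable_fst).mul hm
  have hmeas' : Measurable fun q : X × X => f q.2 * min (ks q.2 q.1) (k q.2 q.1) :=
    hmeas.comp measurable_swap
  have hmx : ∀ x, Measurable fun y => min (ks x y) (k x y) :=
    fun x => hm.comp measurable_prodMk_left
  -- The Dirac part sees only `A ∩ B`, so it is symmetric without any balance condition.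
  have e : ∀ A B, MeasurableSet A → MeasurableSet B →
      ∫⁻ x in A, mhKernel μ k ks x B ∂μ.withDensity f
        = ∫⁻ q in A ×ˢ B, f q.1 * min (ks q.1 q.2) (k q.1 q.2) ∂μ.prod μ
          + ∫⁻ x in A ∩ B, rej μ k ks x ∂μ.withDensity f := fun A B hA hB => by
    have hmB : Measurable fun x => ∫⁻ y in B, min (ks x y) (k x y) ∂μ :=
      Measurable.lintegral_prod_right' hm
    calc ∫⁻ x in A, mhKernel μ k ks x B ∂μ.withDensity f
        = ∫⁻ x in A, ((∫⁻ y in B, min (ks x y) (k x y) ∂μ) + B.indicator (rej μ k ks) x)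
            ∂μ.withDensity f := by
          refine lintegral_congr fun x => ?_
          rw [mhKernel_apply hk hks, Measure.add_apply, Measure.smul_apply,
            withDensity_apply _ hB, Measure.dirac_apply' _ hB]
          by_cases hx : x ∈ B <;> simp [hx]
      _ = _ := by
          rw [lintegral_add_left hmB, lintegral_indicator hB, Measure.restrict_restrict hB,
            Set.inter_comm B A, setLIntegral_withDensity_eq_setLIntegral_mul _ hf hmB hA,
            ← Measure.prod_restrict, lintegral_prod _ hmeas.aemeasurable]
          congr 1
          refine lintegral_congr fun x => ?_
          rw [Pi.mul_apply, ← lintegral_const_mul _ (hmx x)]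
  rw [e A B hA hB, e B A hB hA, Set.inter_comm B A]
  congr 1
  rw [lintegral_congr_ae (ae_restrict_of_ae hbal'), ← Measure.prod_restrict,
    ← Measure.prod_restrict, lintegral_prod_symm _ hmeas'.aemeasurable,
    lintegral_prod _ hmeas.aemeasurable]

/-! ### Identification of the Metropolis-Hastings kernels -/

/-- `dens` is chosen separately for each `x`; it is traded for a jointly measurable density off a
null set depending on `x`. -/
theorem ae_dens_eq {μ : Measure X} [SigmaFinite μ] {K : Kernel X X} {k : X → X → ℝ≥0∞}
    (hk : Measurable (Function.uncurry k)) (hK : ∀ x, K x = μ.withDensity (k x)) (x : X) :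
    dens μ K x =ᵐ[μ] fun y => (k x y).toReal := by
  have hkx : Measurable (k x) := hk.comp measurable_prodMk_left
  have h := Measure.rnDeriv_withDensity μ hkx
  filter_upwards [h] with y hy
  rw [dens, hK, hy]

theorem lintegral_density_eq_one {μ : Measure X} {K : Kernel X X} [IsMarkovKernel K]
    {k : X → X → ℝ≥0∞} (hK : ∀ x, K x = μ.withDensity (k x)) (x : X) :
    ∫⁻ y, k x y ∂μ = 1 := by
  have h := measure_univ (μ := K x)
  rwa [hK, withDensity_apply _ .univ, Measure.restrict_univ] at h

/-- Transition densities of a kernel and its time-reversal agree on the diagonal at atoms. -/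
theorem diag_eq_of_balance {μ : Measure X} [SFinite μ] {f : X → ℝ≥0∞}
    (hf0 : ∀ᵐ x ∂μ, f x ≠ 0) (hft : ∀ᵐ x ∂μ, f x ≠ ∞) {k ks : X → X → ℝ≥0∞}
    (hbal : ∀ᵐ q ∂μ.prod μ, f q.1 * ks q.1 q.2 = f q.2 * k q.2 q.1) {x : X} (hx : μ {x} ≠ 0) :
    ks x x = k x x := by
  have hxx : μ.prod μ {(x, x)} ≠ 0 := by
    rw [← Set.singleton_prod_singleton, Measure.prod_prod]
    exact mul_ne_zero hx hx
  have h := of_ae_of_measure_singleton_ne_zero hbal hxx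
  exact (ENNReal.mul_right_inj (of_ae_of_measure_singleton_ne_zero hf0 hx)
    (of_ae_of_measure_singleton_ne_zero hft hx)).1 h

section Identification

variable {μ : Measure X} [SigmaFinite μ] {f : X → ℝ≥0∞} {K Ks : Kernel X X} [IsMarkovKernel K]
  [IsMarkovKernel Ks] {k ks : X → X → ℝ≥0∞}

theorem r1_eq_toReal_rej (hf0 : ∀ᵐ x ∂μ, f x ≠ 0) (hft : ∀ᵐ x ∂μ, f x ≠ ∞)
    (hk : Measurable (Function.uncurry k)) (hks : Measurable (Function.uncurry ks))
    (hK : ∀ x, K x = μ.withDensity (k x)) (hKs : ∀ x, Ks x = μ.withDensity (ks x))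
    (hbal : ∀ᵐ q ∂μ.prod μ, f q.1 * ks q.1 q.2 = f q.2 * k q.2 q.1) (x : X) :
    r1 μ K Ks x = (rej μ k ks x).toReal := by
  have hkx : Measurable (k x) := hk.comp measurable_prodMk_left
  have hksx : Measurable (ks x) := hks.comp measurable_prodMk_left
  have hd := ae_dens_eq hk hK x
  have hds := ae_dens_eq hks hKs x
  have hlt := ae_lt_top hkx (ne_of_eq_of_ne (lintegral_density_eq_one hK x) ENNReal.one_ne_top)
  have hlts := ae_lt_top hksx (ne_of_eq_of_ne (lintegral_density_eq_one hKs x) ENNReal.one_ne_top)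
  rw [r1, setIntegral_ne_eq_integral, rej,
    ← integral_toReal (f := fun y => k x y - min (ks x y) (k x y))
      (hkx.sub (hksx.min hkx)).aemeasurable]
  · refine integral_congr_ae ?_
    filter_upwards [hd, hds, hlt, hlts] with y h1 h2 h3 h4
    rw [m1, h1, h2, ENNReal.toReal_sub_of_le (min_le_right _ _) h3.ne,
      ENNReal.toReal_min h4.ne h3.ne]
  · filter_upwards [hlt] with y hy
    exact tsub_le_self.trans_lt hy
  -- At an atom, almost everywhere identities hold exactly, and balance on the diagonal forces `ks x
  -- x = k x x`: nothing is rejected there.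
  · intro hx
    have h1 : dens μ K x x = (k x x).toReal := of_ae_of_measure_singleton_ne_zero hd hx
    have h2 : dens μ Ks x x = (ks x x).toReal := of_ae_of_measure_singleton_ne_zero hds hx
    rw [m1, h1, h2, diag_eq_of_balance hf0 hft hbal hx, min_self, sub_self]

theorem M1_eq_toSignedMeasure (hf0 : ∀ᵐ x ∂μ, f x ≠ 0) (hft : ∀ᵐ x ∂μ, f x ≠ ∞)
    (hk : Measurable (Function.uncurry k)) (hks : Measurable (Function.uncurry ks))
    (hK : ∀ x, K x = μ.withDensity (k x)) (hKs : ∀ x, Ks x = μ.withDensity (ks x))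
    (hbal : ∀ᵐ q ∂μ.prod μ, f q.1 * ks q.1 q.2 = f q.2 * k q.2 q.1)
    [IsMarkovKernel (mhKernel μ k ks)] : M1 μ K Ks = ofKernel (mhKernel μ k ks) := by
  funext x
  have hkx : Measurable (k x) := hk.comp measurable_prodMk_left
  have hksx : Measurable (ks x) := hks.comp measurable_prodMk_left
  have hlt := ae_lt_top hkx (ne_of_eq_of_ne (lintegral_density_eq_one hK x) ENNReal.one_ne_top)
  have hlts := ae_lt_top hksx (ne_of_eq_of_ne (lintegral_density_eq_one hKs x) ENNReal.one_ne_top)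
  have hmin : m1 μ K Ks x =ᵐ[μ] fun y => (min (ks x y) (k x y)).toReal := by
    filter_upwards [ae_dens_eq hk hK x, ae_dens_eq hks hKs x, hlt, hlts] with y h1 h2 h3 h4
    rw [m1, h1, h2, ENNReal.toReal_min h4.ne h3.ne]
  have hmlt : ∫⁻ y, min (ks x y) (k x y) ∂μ ≠ ∞ :=
    ((lintegral_mono fun y => min_le_right _ _).trans_lt
      ((lintegral_density_eq_one hK x).trans_lt ENNReal.one_lt_top)).ne
  have hrlt : rej μ k ks x ≠ ∞ :=
    ((lintegral_mono fun y => tsub_le_self).trans_lt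
      ((lintegral_density_eq_one hK x).trans_lt ENNReal.one_lt_top)).ne
  have hfin : IsFiniteMeasure (μ.withDensity fun y => min (ks x y) (k x y)) :=
    isFiniteMeasure_withDensity hmlt
  ext A hA
  rw [M1, ofKernel, Measure.toSignedMeasure_apply_measurable hA, measureReal_def,
    mhKernel_apply hk hks, WithDensityᵥEq.congr_ae hmin,
    withDensityᵥ_toReal (hksx.min hkx).aemeasurable hmlt,
    r1_eq_toReal_rej hf0 hft hk hks hK hKs hbal, add_apply, smul_apply,
    Measure.toSignedMeasure_apply_measurable hA, Measure.toSignedMeasure_apply_measurable hA,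
    Measure.add_apply, Measure.smul_apply, smul_eq_mul, smul_eq_mul,
    ENNReal.toReal_add (measure_ne_top _ _)
    (ENNReal.mul_ne_top hrlt (measure_ne_top _ _)), ENNReal.toReal_mul]
  rfl

/-- `max + min` is the sum of the densities, and the atoms of `M1` and `M2` cancel. The signed
kernel thereby reduces to Markov kernels. -/
theorem M2_eq (hK : ∀ x, K x = μ.withDensity (k x)) (hKs : ∀ x, Ks x = μ.withDensity (ks x))
    (x : X) : M2 μ K Ks x = ofKernel K x + ofKernel Ks x - M1 μ K Ks x := by
  have hi : ∀ (L : Kernel X X) [IsMarkovKernel L], Integrable (dens μ L x) μ :=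
    fun L _ => Measure.integrable_toReal_rnDeriv
  have him : Integrable (m1 μ K Ks x) μ := (hi Ks).inf (hi K)
  have hv : ∀ (L : Kernel X X) [IsMarkovKernel L], L x ≪ μ →
      μ.withDensityᵥ (dens μ L x) = ofKernel L x := fun L _ hL => by
    ext A hA
    rw [withDensityᵥ_apply (hi L) hA, ofKernel, Measure.toSignedMeasure_apply_measurable hA]
    exact Measure.setIntegral_toReal_rnDeriv hL A
  have hm2 : m2 μ K Ks x = dens μ K x + dens μ Ks x - m1 μ K Ks x := by
    funext y
    simp only [m2, m1, Pi.add_apply, Pi.sub_apply]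
    linarith [max_add_min (dens μ Ks x y) (dens μ K x y)]
  rw [M2, M1, hm2, withDensityᵥ_sub ((hi K).add (hi Ks)) him, withDensityᵥ_add (hi K) (hi Ks),
    hv K (hK x ▸ withDensity_absolutelyContinuous _ _),
    hv Ks (hKs x ▸ withDensity_absolutelyContinuous _ _), sub_sub]

end Identification

/-! ### The action of the kernels on bounded functions -/

theorem act_ofKernel (Q : Kernel X X) [IsMarkovKernel Q] (h : X → ℝ) (x : X) :
    act (ofKernel Q) h x = ∫ y, h y ∂Q x :=
  VectorMeasure.integral_toSignedMeasure

theorem act_add_sub {K₁ K₂ K₃ : Kernel X X} [IsMarkovKernel K₁] [IsMarkovKernel K₂]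
    [IsMarkovKernel K₃] {h : X → ℝ} (hm : Measurable h) {b : ℝ} (hb : ∀ x, |h x| ≤ b) (x : X) :
    act (fun x => ofKernel K₁ x + ofKernel K₂ x - ofKernel K₃ x) h x
      = ∫ y, h y ∂K₁ x + ∫ y, h y ∂K₂ x - ∫ y, h y ∂K₃ x := by
  have hi : ∀ (K : Kernel X X) [IsMarkovKernel K], VectorMeasure.Integrable (ofKernel K x) h :=
    fun K _ => by
      rw [VectorMeasure.Integrable, ofKernel, Measure.variation_toSignedMeasure]
      exact integrable_of_abs_le hm hb
  rw [act, VectorMeasure.integral_sub_vectorMeasure ((hi K₁).add_vectorMeasure (hi K₂)) (hi K₃),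
    VectorMeasure.integral_add_vectorMeasure (hi K₁) (hi K₂)]
  simp only [ofKernel, VectorMeasure.integral_toSignedMeasure]

theorem measurable_integral_kernel (Q : Kernel X X) [IsMarkovKernel Q] {h : X → ℝ}
    (hm : Measurable h) : Measurable fun x => ∫ y, h y ∂Q x :=
  hm.stronglyMeasurable.integral_kernel.measurable

theorem abs_integral_kernel_le (Q : Kernel X X) [IsMarkovKernel Q] {h : X → ℝ} {b : ℝ}
    (hb : ∀ x, |h x| ≤ b) (x : X) : |∫ y, h y ∂Q x| ≤ b := by
  have := norm_integral_le_of_norm_le_const (μ := Q x) (f := h) (C := b)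
    (Filter.Eventually.of_forall hb)
  simpa using this

theorem integral_integral_kernel {π : Measure X} [IsProbabilityMeasure π] {Q : Kernel X X}
    [IsMarkovKernel Q] (hQ : Q.Invariant π) {h : X → ℝ} (hm : Measurable h) {b : ℝ}
    (hb : ∀ x, |h x| ≤ b) : ∫ x, ∫ y, h y ∂Q x ∂π = ∫ x, h x ∂π := by
  have hc : (Q ∘ₖ Kernel.const Unit π) () = π := by
    rw [← Measure.comp_eq_comp_const_apply, hQ.def]
  have hi : Integrable h ((Q ∘ₖ Kernel.const Unit π) ()) := by
    rw [hc]
    exact integrable_of_abs_le hm hb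
  have := Kernel.integral_comp hi
  rw [hc, Kernel.const_apply] at this
  exact this.symm

theorem integral_kernel_sub_const (Q : Kernel X X) [IsMarkovKernel Q] {h : X → ℝ}
    (hm : Measurable h) {b : ℝ} (hb : ∀ x, |h x| ≤ b) (c : ℝ) (x : X) :
    ∫ y, (h y - c) ∂Q x = ∫ y, h y ∂Q x - c := by
  rw [integral_sub (integrable_of_abs_le hm hb) (integrable_const _)]
  simp

theorem abs_indicator_one_le {α : Type*} (A : Set α) (x : α) : |A.indicator (fun _ => (1 : ℝ)) x| ≤ 1 := by
  by_cases hx : x ∈ A <;> simp [hx]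

theorem UniformlyErgodic.ofKernel_of_abs_le {π : Measure X} [IsProbabilityMeasure π]
    {Q : Kernel X X} [IsMarkovKernel Q] (hQ : Q.Invariant π) {ε : ℝ} (hε : 0 ≤ ε) (hε1 : ε < 1)
    (hbd : ∀ h : X → ℝ, ∀ b, Measurable h → (∀ x, |h x| ≤ b) → ∀ x,
      |∫ y, h y ∂Q x - ∫ y, h y ∂π| ≤ ε * b) : UniformlyErgodic (ofKernel Q) π := by
  refine .of_act hε hε1 (fun A hA x => ?_) (fun h b hm hb => ?_) (fun h b c hm hb x => ?_)
    (fun h b hm hb => ?_) (fun h b hm hb x => ?_)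
  · rw [act_ofKernel, ofKernel, Measure.toSignedMeasure_apply_measurable hA,
      integral_indicator hA]
    simp
  · exact (funext (act_ofKernel Q h)) ▸ measurable_integral_kernel Q hm
  · rw [act_ofKernel, act_ofKernel, integral_kernel_sub_const Q hm hb]
  · simp_rw [act_ofKernel]
    exact integral_integral_kernel hQ hm hb
  · rw [act_ofKernel]
    exact hbd h b hm hb x

theorem UniformlyErgodic.add_sub_of_abs_le {π : Measure X} [IsProbabilityMeasure π]
    {K₁ K₂ K₃ : Kernel X X} [IsMarkovKernel K₁] [IsMarkovKernel K₂] [IsMarkovKernel K₃]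
    (h₁ : K₁.Invariant π) (h₂ : K₂.Invariant π) (h₃ : K₃.Invariant π) {ε : ℝ} (hε : 0 ≤ ε)
    (hε1 : ε < 1)
    (hbd : ∀ h : X → ℝ, ∀ b, Measurable h → (∀ x, |h x| ≤ b) → ∀ x,
      |∫ y, h y ∂K₁ x + ∫ y, h y ∂K₂ x - ∫ y, h y ∂K₃ x - ∫ y, h y ∂π| ≤ ε * b) :
    UniformlyErgodic (fun x => ofKernel K₁ x + ofKernel K₂ x - ofKernel K₃ x) π := by
  have hm1 : ∀ A : Set X, MeasurableSet A → Measurable (A.indicator fun _ => (1 : ℝ)) :=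
    fun A hA => measurable_const.indicator hA
  refine .of_act hε hε1 (fun A hA x => ?_) (fun h b hm hb => ?_) (fun h b c hm hb x => ?_)
    (fun h b hm hb => ?_) (fun h b hm hb x => ?_)
  · rw [act_add_sub (hm1 A hA) (abs_indicator_one_le A), sub_apply, add_apply]
    simp only [ofKernel, Measure.toSignedMeasure_apply_measurable hA, integral_indicator hA]
    simp
  · rw [funext (act_add_sub hm hb)]
    exact ((measurable_integral_kernel K₁ hm).add (measurable_integral_kernel K₂ hm)).sub
      (measurable_integral_kernel K₃ hm)
  · have hb' : ∀ y, |h y - c| ≤ b + |c| := fun y =>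
      (abs_sub _ _).trans (add_le_add_left (hb y) _)
    rw [act_add_sub hm hb, act_add_sub (hm.sub_const c) hb', integral_kernel_sub_const _ hm hb,
      integral_kernel_sub_const _ hm hb, integral_kernel_sub_const _ hm hb]
    ring
  · have hi : ∀ (K : Kernel X X) [IsMarkovKernel K], Integrable (fun x => ∫ y, h y ∂K x) π :=
      fun K _ => integrable_of_abs_le (measurable_integral_kernel K hm)
        (abs_integral_kernel_le K hb)
    simp_rw [act_add_sub hm hb]
    rw [integral_sub (f := fun x => ∫ y, h y ∂K₁ x + ∫ y, h y ∂K₂ x) ((hi K₁).add (hi K₂))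
      (hi K₃), integral_add (hi K₁) (hi K₂),
      integral_integral_kernel h₁ hm hb, integral_integral_kernel h₂ hm hb,
      integral_integral_kernel h₃ hm hb]
    ring
  · rw [act_add_sub hm hb]
    exact hbd h b hm hb x

/-! ### Closeness of the Metropolis-Hastings kernel to `π` -/

/-- The constant is `10 = 4 + 6`: the absolutely continuous part is off by `4δ` in `L¹`, and the
rejected mass is at most `2δ + 4δ`. -/
theorem abs_integral_mhKernel_sub_le {μ : Measure X} [SFinite μ] {f : X → ℝ≥0∞}
    (hf : Measurable f) (hf1 : ∫⁻ y, f y ∂μ = 1) {k ks : X → X → ℝ≥0∞}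
    (hk : Measurable (Function.uncurry k)) (hks : Measurable (Function.uncurry ks))
    (hk1 : ∀ x, ∫⁻ y, k x y ∂μ = 1) (hks1 : ∀ x, ∫⁻ y, ks x y ∂μ = 1) {x : X} {δ : ℝ}
    (hkf : ∫ y, |(k x y).toReal - (f y).toReal| ∂μ ≤ 2 * δ)
    (hksf : ∫ y, |(ks x y).toReal - (f y).toReal| ∂μ ≤ 2 * δ)
    {h : X → ℝ} (hm : Measurable h) {b : ℝ} (hb : ∀ x, |h x| ≤ b) :
    |∫ y, h y ∂mhKernel μ k ks x - ∫ y, h y ∂μ.withDensity f| ≤ 10 * δ * b := by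
  have hb0 : 0 ≤ b := (abs_nonneg _).trans (hb x)
  have hkx : Measurable (k x) := hk.comp measurable_prodMk_left
  have hksx : Measurable (ks x) := hks.comp measurable_prodMk_left
  have hmx : Measurable fun y => min (ks x y) (k x y) := hksx.min hkx
  have hft := ne_of_eq_of_ne hf1 ENNReal.one_ne_top
  have hkt := ne_of_eq_of_ne (hk1 x) ENNReal.one_ne_top
  have hkst := ne_of_eq_of_ne (hks1 x) ENNReal.one_ne_top
  have hmt : ∫⁻ y, min (ks x y) (k x y) ∂μ ≠ ∞ :=
    ((lintegral_mono fun y => min_le_right _ _).trans_lt hkt.lt_top).ne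
  have hrt : rej μ k ks x ≠ ∞ := ((lintegral_mono fun y => tsub_le_self).trans_lt hkt.lt_top).ne
  have hfi := integrable_toReal_of_lintegral_ne_top hf.aemeasurable hft
  have hki := integrable_toReal_of_lintegral_ne_top hkx.aemeasurable hkt
  have hksi := integrable_toReal_of_lintegral_ne_top hksx.aemeasurable hkst
  have hmi := integrable_toReal_of_lintegral_ne_top hmx.aemeasurable hmt
  have hlt := ae_lt_top hkx hkt
  have hlts := ae_lt_top hksx hkst
  have hmf : ∫ y, |(min (ks x y) (k x y)).toReal - (f y).toReal| ∂μ ≤ 4 * δ := by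
    calc ∫ y, |(min (ks x y) (k x y)).toReal - (f y).toReal| ∂μ
        ≤ ∫ y, (|(ks x y).toReal - (f y).toReal| + |(k x y).toReal - (f y).toReal|) ∂μ := by
          refine integral_mono_ae (hmi.sub hfi).abs
            ((hksi.sub hfi).abs.add (hki.sub hfi).abs) ?_
          filter_upwards [hlt, hlts] with y h1 h2
          rw [ENNReal.toReal_min h2.ne h1.ne]
          rcases min_choice (ks x y).toReal (k x y).toReal with h | h <;> rw [h]
          · exact le_add_of_nonneg_right (abs_nonneg _)
          · exact le_add_of_nonneg_left (abs_nonneg _)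
      _ ≤ 4 * δ := by
          have := integral_add (hksi.sub hfi).abs (hki.sub hfi).abs
          simp only [Pi.sub_apply] at this
          linarith
  have hrej : (rej μ k ks x).toReal ≤ 6 * δ := by
    rw [rej, ← integral_toReal (f := fun y => k x y - min (ks x y) (k x y))
      (hkx.sub hmx).aemeasurable
      (hlt.mono fun y hy => tsub_le_self.trans_lt hy)]
    calc ∫ y, (k x y - min (ks x y) (k x y)).toReal ∂μ
        ≤ ∫ y, (|(k x y).toReal - (f y).toReal|
            + |(min (ks x y) (k x y)).toReal - (f y).toReal|) ∂μ := by
          refine integral_mono_of_nonneg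
            (Filter.Eventually.of_forall fun _ => ENNReal.toReal_nonneg)
            ((hki.sub hfi).abs.add (hmi.sub hfi).abs) ?_
          filter_upwards [hlt] with y h1
          rw [ENNReal.toReal_sub_of_le (min_le_right _ _) h1.ne]
          linarith [le_abs_self ((k x y).toReal - (f y).toReal),
            neg_abs_le ((min (ks x y) (k x y)).toReal - (f y).toReal)]
      _ ≤ 6 * δ := by
          have := integral_add (hki.sub hfi).abs (hmi.sub hfi).abs
          simp only [Pi.sub_apply] at this
          linarith
  have hfin : IsFiniteMeasure (μ.withDensity fun y => min (ks x y) (k x y)) :=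
    isFiniteMeasure_withDensity hmt
  have hdi : Integrable h (rej μ k ks x • Measure.dirac x) :=
    (integrable_of_abs_le hm hb).smul_measure hrt
  have h1 := integral_withDensity_sub_le hmx hf hmt hft hm hb
  rw [mhKernel_apply hk hks, integral_add_measure (integrable_of_abs_le hm hb) hdi,
    integral_smul_measure, integral_dirac' _ _ hm.stronglyMeasurable, smul_eq_mul, add_sub_right_comm]
  have h2 : |(rej μ k ks x).toReal * h x| ≤ 6 * δ * b := by
    rw [abs_mul, abs_of_nonneg ENNReal.toReal_nonneg]
    exact mul_le_mul hrej (hb x) (abs_nonneg _) (ENNReal.toReal_nonneg.trans hrej)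
  have h3 := mul_le_mul_of_nonneg_left hmf hb0
  refine (abs_add_le _ _).trans ?_
  linarith

/-- If the laws `K x` and `Ks x` are all close to `π` in total variation, then both
Metropolis-Hastings kernels are uniformly ergodic. -/
theorem uniformlyErgodic_M1_M2 {μ : Measure X} [SigmaFinite μ] {f : X → ℝ≥0∞}
    (hf : Measurable f) [IsProbabilityMeasure (μ.withDensity f)] (hf0 : ∀ᵐ x ∂μ, f x ≠ 0)
    {K Ks : Kernel X X} [IsMarkovKernel K] [IsMarkovKernel Ks] (hK : HasJointDensity μ K)
    (hKs : HasJointDensity μ Ks) (hrev : IsReversal (μ.withDensity f) K Ks)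
    (hinv : K.Invariant (μ.withDensity f)) (hinvs : Ks.Invariant (μ.withDensity f)) {δ : ℝ}
    (hδ0 : 0 ≤ δ) (hδ : 14 * δ < 1)
    (htv : ∀ x A, MeasurableSet A → |(K x).real A - (μ.withDensity f).real A| ≤ δ)
    (htvs : ∀ x A, MeasurableSet A → |(Ks x).real A - (μ.withDensity f).real A| ≤ δ) :
    UniformlyErgodic (M1 μ K Ks) (μ.withDensity f) ∧
      UniformlyErgodic (M2 μ K Ks) (μ.withDensity f) := by
  obtain ⟨k, hk, hKk⟩ := hK
  obtain ⟨ks, hks, hKsk⟩ := hKs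
  have hk1 := lintegral_density_eq_one hKk
  have hks1 := lintegral_density_eq_one hKsk
  have hf1 : ∫⁻ y, f y ∂μ = 1 := by
    have h := measure_univ (μ := μ.withDensity f)
    rwa [withDensity_apply _ .univ, Measure.restrict_univ] at h
  have hft := ne_of_eq_of_ne hf1 ENNReal.one_ne_top
  have hft' : ∀ᵐ x ∂μ, f x ≠ ∞ := (ae_lt_top hf hft).mono fun _ h => h.ne
  have hbal := hrev.ae_mul_eq hf hk hks hKk hKsk
  have hkx : ∀ x, Measurable (k x) := fun x => hk.comp measurable_prodMk_left
  have hksx : ∀ x, Measurable (ks x) := fun x => hks.comp measurable_prodMk_left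
  have hkt := fun x => ne_of_eq_of_ne (hk1 x) ENNReal.one_ne_top
  have hkst := fun x => ne_of_eq_of_ne (hks1 x) ENNReal.one_ne_top
  have hkf := fun x => integral_abs_toReal_sub_le (hkx x) hf (hkt x) hft (hKk x ▸ htv x)
  have hksf := fun x => integral_abs_toReal_sub_le (hksx x) hf (hkst x) hft (hKsk x ▸ htvs x)
  have hQM : IsMarkovKernel (mhKernel μ k ks) := isMarkovKernel_mhKernel hk hks hk1
  have hQ := (isReversible_mhKernel hk hks hf hbal).invariant
  have hM1 := M1_eq_toSignedMeasure hf0 hft' hk hks hKk hKsk hbal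
  have hM2 : M2 μ K Ks = fun x => ofKernel K x + ofKernel Ks x - ofKernel (mhKernel μ k ks) x := by
    funext x
    rw [M2_eq hKk hKsk, hM1]
  have hbQ := fun (h : X → ℝ) (b : ℝ) (hm : Measurable h) (hb : ∀ x, |h x| ≤ b) (x : X) =>
    abs_integral_mhKernel_sub_le hf hf1 hk hks hk1 hks1 (hkf x) (hksf x) hm hb
  constructor
  · rw [hM1]
    exact .ofKernel_of_abs_le hQ (by linarith) (by linarith) hbQ
  · rw [hM2]
    -- `14 = 2 + 2 + 10`: deviations of `K`, `Ks` and the first Metropolis-Hastings kernel; the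
    -- coefficients `1 + 1 - 1` leave a single `π`.
    refine .add_sub_of_abs_le hinv hinvs hQ (by linarith : 0 ≤ 14 * δ) hδ fun h b hm hb x => ?_
    have hb0 : 0 ≤ b := (abs_nonneg _).trans (hb x)
    have h1 := (integral_withDensity_sub_le (hkx x) hf (hkt x) hft hm hb).trans
      (mul_le_mul_of_nonneg_left (hkf x) hb0)
    have h2 := (integral_withDensity_sub_le (hksx x) hf (hkst x) hft hm hb).trans
      (mul_le_mul_of_nonneg_left (hksf x) hb0)
    have h3 := hbQ h b hm hb x
    rw [← hKk] at h1
    rw [← hKsk] at h2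
    rw [abs_le] at h1 h2 h3 ⊢
    constructor <;> linarith

/-! ### Powers of uniformly ergodic Markov kernels -/

theorem iter_ofKernel (P : Kernel X X) [IsMarkovKernel P] (n : ℕ) (x : X) {A : Set X}
    (hA : MeasurableSet A) : iter (ofKernel P) n x A = ((P ^ n) x).real A := by
  induction n generalizing x with
  | zero =>
    rw [pow_zero]
    change A.indicator (fun _ => 1) x = (Kernel.id x).real A
    rw [Kernel.id_apply, measureReal_def, Measure.dirac_apply' _ hA]
    by_cases hx : x ∈ A <;> simp [hx]
  | succ n ih =>
    have := isMarkovKernel_pow P n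
    -- The outermost `act` is the first step of the chain from `x`, matching `P ^ (n + 1) = P ^ n ∘ₖ
    -- P`.
    rw [iter, Function.iterate_succ_apply', act_ofKernel]
    change ∫ y, iter (ofKernel P) n y A ∂P x = _
    simp_rw [ih, measureReal_def]
    rw [integral_toReal ((P ^ n).measurable_coe hA).aemeasurable
      (Filter.Eventually.of_forall fun y => measure_lt_top _ _), pow_succ]
    exact congrArg _ (Kernel.comp_apply' _ _ _ hA).symm

theorem UniformlyErgodic.eventually_abs_sub_le {P : Kernel X X} [IsMarkovKernel P]
    {π : Measure X} (h : UniformlyErgodic (ofKernel P) π) {δ : ℝ} (hδ : 0 < δ) :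
    ∃ N : ℕ, 1 ≤ N ∧ ∀ n, N ≤ n → ∀ x A, MeasurableSet A →
      |((P ^ n) x).real A - π.real A| ≤ δ := by
  obtain ⟨C, ρ, hρ, hρ1, hb⟩ := h.bound
  have ht : Filter.Tendsto (fun n : ℕ => C * ρ ^ n) Filter.atTop (nhds 0) := by
    simpa using (tendsto_pow_atTop_nhds_zero_of_lt_one hρ hρ1).const_mul C
  obtain ⟨N, hN⟩ := Filter.eventually_atTop.1 (ht.eventually_lt_const hδ)
  -- The ergodicity bound starts at `n = 1`; `HasJointDensity.pow` also needs `1 ≤ n`.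
  refine ⟨max N 1, le_max_right _ _, fun n hn x A hA => ?_⟩
  have h1 := (le_iSup (fun x => tvDist (iter (ofKernel P) n x) π.real) x).trans
    (hb n ((le_max_right _ _).trans hn))
  have h2 := (le_iSup₂ (f := fun (A : Set X) (_ : MeasurableSet A) =>
    ENNReal.ofReal |iter (ofKernel P) n x A - π.real A|) A hA).trans h1
  rw [iter_ofKernel P n x hA] at h2
  exact (ENNReal.ofReal_le_ofReal_iff hδ.le).1
    (h2.trans (ENNReal.ofReal_le_ofReal (hN n ((le_max_left _ _).trans hn)).le))

theorem invariant_pow {P : Kernel X X} {π : Measure X} (h : P.Invariant π) (n : ℕ) :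
    (P ^ n).Invariant π := by
  induction n with
  | zero =>
    rw [pow_zero]
    exact Measure.bind_dirac
  | succ n ih =>
    rw [pow_succ]
    exact ih.comp h

/-- Testing with `u = 1` leaves the total mass of `K x`, which is 1. -/
theorem IsReversal.invariant {π : Measure X} {K Ks : Kernel X X} [IsMarkovKernel K]
    (h : IsReversal π K Ks) : Ks.Invariant π := by
  ext A hA
  rw [Measure.bind_apply hA Ks.aemeasurable]
  have := h 1 (A.indicator 1) measurable_one (measurable_one.indicator hA)
  simpa [lintegral_indicator_one hA] using this

/-- `μ` is recovered from a probability measure through the density `f⁻¹`, finite almost everywhere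
because `f ≠ 0`. This supplies Fubini and uniqueness of densities. -/
theorem sigmaFinite_of_withDensity {μ : Measure X} {f : X → ℝ≥0∞} (hf : Measurable f)
    [IsProbabilityMeasure (μ.withDensity f)] (hf0 : ∀ᵐ x ∂μ, f x ≠ 0) : SigmaFinite μ := by
  have hf1 : ∫⁻ y, f y ∂μ ≠ ∞ := by
    have h := measure_ne_top (μ.withDensity f) Set.univ
    rwa [withDensity_apply _ .univ, Measure.restrict_univ] at h
  rw [← withDensity_inv_same hf hf0 ((ae_lt_top hf hf1).mono fun _ h => h.ne)]
  refine SigmaFinite.withDensity_of_ne_top ?_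
  exact (withDensity_absolutelyContinuous μ f).ae_le (hf0.mono fun x hx => ENNReal.inv_ne_top.2 hx)

end MHReversal

end

theorem mainTheorem9 {X : Type*} [MeasurableSpace X]
    (μ π : Measure X) [IsProbabilityMeasure π]
    (P Ps : Kernel X X) [IsMarkovKernel P] [IsMarkovKernel Ps]
    -- `π` has a density with respect to `μ`, and its zero set is `μ`-null
    (f : X → ℝ≥0∞) (hf : Measurable f) (hπ : π = μ.withDensity f) (hf0 : μ {x | f x = 0} = 0)
    -- `P(x, ·)` and `P*(x, ·)` have densities with respect to `μ`
    (p ps : X → X → ℝ≥0∞) (hp : Measurable (Function.uncurry p))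
    (hps : Measurable (Function.uncurry ps))
    (hP : ∀ x, P x = μ.withDensity (p x)) (hPs : ∀ x, Ps x = μ.withDensity (ps x))
    -- `π` is stationary for `P`
    (hinv : P.Invariant π)
    -- `P*` is the time-reversal of `P`: `π(dx) P*(x, dy) = π(dy) P(y, dx)`
    (hrev : π.compProd Ps = (π.compProd P).map Prod.swap)
    (hPue : MHReversal.UniformlyErgodic (MHReversal.ofKernel P) π)
    (hPsue : MHReversal.UniformlyErgodic (MHReversal.ofKernel Ps) π) :
    ∃ N : ℕ, 1 ≤ N ∧ ∀ n : ℕ, N ≤ n →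
      MHReversal.UniformlyErgodic (MHReversal.M1 μ (P ^ n) (Ps ^ n)) π ∧
      MHReversal.UniformlyErgodic (MHReversal.M2 μ (P ^ n) (Ps ^ n)) π := by
  -- With `δ = 1 / 28` the contraction factor `14δ` is `1 / 2`; any `δ < 1 / 14` would serve.
  obtain ⟨N₁, hN₁, h₁⟩ := hPue.eventually_abs_sub_le (δ := 1 / 28) (by norm_num)
  obtain ⟨N₂, -, h₂⟩ := hPsue.eventually_abs_sub_le (δ := 1 / 28) (by norm_num)
  have hr := MHReversal.isReversal_of_compProd_eq hrev
  have hinvs := hr.invariant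
  have hf0' : ∀ᵐ x ∂μ, f x ≠ 0 := by
    rw [ae_iff]
    simpa using hf0
  subst hπ
  have hσ : SigmaFinite μ := MHReversal.sigmaFinite_of_withDensity hf hf0'
  have hPd : MHReversal.HasJointDensity μ P := ⟨p, hp, hP⟩
  have hPsd : MHReversal.HasJointDensity μ Ps := ⟨ps, hps, hPs⟩
  refine ⟨max N₁ N₂, le_max_of_le_left hN₁, fun n hn => ?_⟩
  have hn₁ := (le_max_left _ _).trans hn
  have hn₂ := (le_max_right _ _).trans hn
  have := MHReversal.isMarkovKernel_pow P n
  have := MHReversal.isMarkovKernel_pow Ps n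
  exact MHReversal.uniformlyErgodic_M1_M2 hf hf0' (hPd.pow (hN₁.trans hn₁))
    (hPsd.pow (hN₁.trans hn₁)) (hr.pow n) (MHReversal.invariant_pow hinv n)
    (MHReversal.invariant_pow hinvs n) (by norm_num : (0 : ℝ) ≤ 1 / 28) (by norm_num) (h₁ n hn₁)
    (h₂ n hn₂)
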